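/- A \emph{0-1-tree} is a nonempty rooted plane tree on unlabeled vertices in which every non-leaf vertex has one or two children, every child is designated a left child or a right child (even if it is an only child), and every vertex that has two children is labeled $0$ or $1$. A \emph{right edge} is an edge from a vertex to its right child. For positive integers $n$ and $k$, the \emph{Boolean-Narayana number} $\mathrm{BoNa}(n,k)$ is the number of 0-1-trees on $n$ vertices that have exactly $k-1$ right edges. A finite sequence $a_1,a_2,\dots,a_n$ of nonnegative real numbers is \emph{log-concave} if $a_{i-1}a_{i+1}\le a_i^2$ for all $1<i<n$. \textbf{Corollary.} For every fixed positive integer $n$, the sequence $\mathrm{BoNa}(n,1),\mathrm{BoNa}(n,2),\dots,\mathrm{BoNa}(n,n)$ is log-concave. -/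

import Mathlib

/-- A (nonempty) binary plane tree in which every vertex having two children carries a label
0 or 1. The constructors list the four possibilities for the root: no child, only a left child,
only a right child, or two children (with the label of the root). -/
inductive ZeroOneTree : Type where
  | leaf : ZeroOneTree
  | left (l : ZeroOneTree) : ZeroOneTree
  | right (r : ZeroOneTree) : ZeroOneTree
  | both (label : Fin 2) (l r : ZeroOneTree) : ZeroOneTree

namespace ZeroOneTree

/-- The number of vertices. -/
def numVertices : ZeroOneTree → ℕ
  | leaf => 1
  | left l => l.numVertices + 1
  | right r => r.numVertices + 1
  | both _ l r => l.numVertices + r.numVertices + 1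

/-- The number of right edges, that is, of edges from a vertex to its right child. -/
def numRightEdges : ZeroOneTree → ℕ
  | leaf => 0
  | left l => l.numRightEdges
  | right r => r.numRightEdges + 1
  | both _ l r => l.numRightEdges + r.numRightEdges + 1

/-- There are finitely many 0-1-trees on at most `n` vertices. -/
theorem finite_numVertices_le (n : ℕ) : {T : ZeroOneTree | T.numVertices ≤ n}.Finite := by
  induction n with
  | zero =>
    refine Set.Finite.subset Set.finite_empty ?_
    intro T hT
    cases T <;> simp [numVertices] at hT
  | succ n ih =>
    refine Set.Finite.subset
      ((((Set.finite_singleton leaf).union (ih.image left)).union (ih.image right)).union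
        (((Set.finite_univ (α := Fin 2)).prod (ih.prod ih)).image
          (fun p => both p.1 p.2.1 p.2.2))) ?_
    intro T hT
    cases T with
    | leaf => simp
    | left l =>
      simp only [Set.mem_ofPred_eq, numVertices] at hT
      exact Or.inl (Or.inl (Or.inr ⟨l, by simp only [Set.mem_ofPred_eq]; omega, rfl⟩))
    | right r =>
      simp only [Set.mem_ofPred_eq, numVertices] at hT
      exact Or.inl (Or.inr ⟨r, by simp only [Set.mem_ofPred_eq]; omega, rfl⟩)
    | both b l r =>
      simp only [Set.mem_ofPred_eq, numVertices] at hT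
      exact Or.inr ⟨(b, l, r), ⟨Set.mem_univ _, by simp only [Set.mem_ofPred_eq]; omega,
        by simp only [Set.mem_ofPred_eq]; omega⟩, rfl⟩

end ZeroOneTree

/-- The 0-1-trees on `n` vertices with exactly `k - 1` right edges (none if `k = 0`). -/
def boNaTrees (n k : ℕ) : Set ZeroOneTree :=
  {T | T.numVertices = n ∧ T.numRightEdges + 1 = k}

/-- The set counted by `boNa` is finite, so that `Set.ncard` is its true cardinality. -/
theorem finite_boNaTrees (n k : ℕ) : (boNaTrees n k).Finite :=
  (ZeroOneTree.finite_numVertices_le n).subset fun _ hT => hT.1.le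

/-- The Boolean-Narayana number: the number of 0-1-trees on `n` vertices that have exactly
`k - 1` right edges. -/
noncomputable def boNa (n k : ℕ) : ℕ := (boNaTrees n k).ncard

/-- The finite sequence `a 1, a 2, …, a n` of real numbers is log-concave: its terms are
nonnegative, and `a (i - 1) * a (i + 1) ≤ a i ^ 2` at every index `i` that has both neighbours
`i - 1` and `i + 1` in `{1, …, n}`. -/
def IsLogConcaveUpTo (n : ℕ) (a : ℕ → ℝ) : Prop :=
  (∀ i, 1 ≤ i → i ≤ n → 0 ≤ a i) ∧
    ∀ i, 1 < i → i < n → a (i - 1) * a (i + 1) ≤ a i ^ 2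

open Polynomial

/-! ### Strongly log-concave coefficient sequences -/

/-- The coefficients of `p` are nonnegative and form a log-concave sequence without internal
zeros, expressed through the `2 × 2` minors of their Toeplitz matrix. -/
def StronglyLogConcave (p : ℝ[X]) : Prop :=
  (∀ i, 0 ≤ p.coeff i) ∧
    ∀ i j, i ≤ j → p.coeff i * p.coeff (j + 1) ≤ p.coeff (i + 1) * p.coeff j

theorem stronglyLogConcave_C {a : ℝ} (ha : 0 ≤ a) : StronglyLogConcave (C a) := by
  refine ⟨fun i => ?_, fun i j _ => ?_⟩
  · rw [coeff_C]; split_ifs <;> simp [ha]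
  · simp [coeff_C]

theorem StronglyLogConcave.X_add_C_mul {p : ℝ[X]} (hp : StronglyLogConcave p) {a : ℝ}
    (ha : 0 ≤ a) : StronglyLogConcave ((X + C a) * p) := by
  obtain ⟨h0, h⟩ := hp
  have hz : ((X + C a) * p).coeff 0 = a * p.coeff 0 := by simp [mul_coeff_zero]
  have hs : ∀ k, ((X + C a) * p).coeff (k + 1) = p.coeff k + a * p.coeff (k + 1) := by
    intro k; simp [add_mul]
  refine ⟨fun i => ?_, fun i j hij => ?_⟩
  · cases i with
    | zero => rw [hz]; exact mul_nonneg ha (h0 0)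
    | succ k => rw [hs]; exact add_nonneg (h0 k) (mul_nonneg ha (h0 _))
  · rcases hij.eq_or_lt with rfl | hlt
    · rw [mul_comm]
    obtain ⟨j, rfl⟩ : ∃ j', j = j' + 1 := ⟨j - 1, by omega⟩
    cases i with
    | zero =>
      rw [hz, hs, hs, hs]
      have h1 := mul_le_mul_of_nonneg_left (h 0 (j + 1) (by omega)) (mul_nonneg ha ha)
      have h2 := mul_nonneg (h0 0) (h0 j)
      have h3 := mul_nonneg ha (mul_nonneg (h0 1) (h0 j))
      simp only [zero_add] at *
      nlinarith
    | succ i =>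
      rw [hs, hs, hs, hs]
      have h1 := mul_le_mul_of_nonneg_left (h (i + 1) (j + 1) (by omega)) (mul_nonneg ha ha)
      have h2 := h i j (by omega)
      have h3 := mul_le_mul_of_nonneg_left
        ((h i (j + 1) (by omega)).trans (h (i + 1) j (by omega))) ha
      nlinarith

/-- A real-rooted polynomial with nonnegative coefficients is strongly log-concave. -/
theorem stronglyLogConcave_of_splits {p : ℝ[X]} (hp : p.Splits) (h0 : ∀ i, 0 ≤ p.coeff i) :
    StronglyLogConcave p := by
  rcases eq_or_ne p 0 with rfl | hne
  · simpa using stronglyLogConcave_C le_rfl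
  have hroots : ∀ r ∈ p.roots, r ≤ 0 := by
    intro r hr
    by_contra! hpos
    have he : p.eval r = 0 := (mem_roots hne).1 hr
    rw [eval_eq_sum, sum_def] at he
    have hlc := (Finset.sum_eq_zero_iff_of_nonneg
      (fun i _ => mul_nonneg (h0 i) (pow_pos hpos i).le)).1 he p.natDegree
      (natDegree_mem_support_of_nonzero hne)
    rcases mul_eq_zero.1 hlc with h | h
    · exact hne (leadingCoeff_eq_zero.1 h)
    · exact (pow_pos hpos _).ne' h
  have key : ∀ s : Multiset ℝ, (∀ r ∈ s, r ≤ 0) →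
      StronglyLogConcave (C p.leadingCoeff * (s.map fun a => X - C a).prod) := by
    intro s
    induction s using Multiset.induction_on with
    | empty => intro _; simpa using stronglyLogConcave_C (h0 p.natDegree)
    | cons a s ih =>
      intro hs
      have := (ih fun r hr => hs r (Multiset.mem_cons_of_mem hr)).X_add_C_mul
        (a := -a) (by linarith [hs a (Multiset.mem_cons_self a s)])
      rw [Multiset.map_cons, Multiset.prod_cons]
      convert this using 1
      simp only [map_neg]
      ring
  rw [hp.eq_prod_roots]
  exact key p.roots hroots

/-! ### Real-rootedness of derivatives -/

theorem Polynomial.Splits.derivative_real {p : ℝ[X]} (hp : p.Splits) :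
    (derivative p).Splits := by
  rw [splits_iff_card_roots] at hp ⊢
  have h1 := card_roots_le_derivative p
  have h2 := card_roots' (derivative p)
  have h3 := natDegree_derivative_le p
  omega

theorem Polynomial.Splits.iterate_derivative_real {p : ℝ[X]} (hp : p.Splits) (k : ℕ) :
    (derivative^[k] p).Splits := by
  induction k with
  | zero => exact hp
  | succ k ih => rw [Function.iterate_succ_apply']; exact ih.derivative_real

theorem natDegree_X_sq_sub_one_pow (n : ℕ) : ((X ^ 2 - 1 : ℝ[X]) ^ n).natDegree = 2 * n := by
  rw [natDegree_pow, show (X ^ 2 - 1 : ℝ[X]) = X ^ 2 - C 1 by simp, natDegree_X_pow_sub_C,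
    mul_comm]

/-- The complex roots of the `m`-th derivative of `(X ^ 2 - 1) ^ (m + 1)` are real; the derivative
is expressed by a Taylor coefficient. -/
theorem real_of_coeff_eq_zero {m : ℕ} {s : ℂ}
    (h : (((C (s ^ 2 - 1) + X * (C (2 * s) + X)) ^ (m + 1) : ℂ[X])).coeff m = 0) :
    ∃ r : ℝ, (r : ℂ) = s := by
  set p : ℝ[X] := (X ^ 2 - 1) ^ (m + 1) with hp
  have hsp : p.Splits := by
    rw [hp, show (X ^ 2 - 1 : ℝ[X]) = (X - C 1) * (X + C 1) by rw [C_1]; ring]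
    exact ((Splits.X_sub_C 1).mul (Splits.X_add_C 1)).pow _
  have hne : derivative^[m] p ≠ 0 := by
    intro h0
    have h1 : (derivative^[m] p).coeff (m + 2) = 0 := by rw [h0]; simp
    rw [coeff_iterate_derivative, show m + 2 + m = p.natDegree by
      rw [hp, natDegree_X_sq_sub_one_pow]; ring] at h1
    have h2 : p.coeff p.natDegree ≠ 0 := by
      rw [coeff_natDegree, Ne, leadingCoeff_eq_zero]
      intro h3
      have := natDegree_X_sq_sub_one_pow (m + 1)
      rw [← hp, h3] at this
      simp at this
    rw [nsmul_eq_mul] at h1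
    rcases mul_eq_zero.1 h1 with h3 | h3
    · have : p.natDegree.descFactorial m = 0 := by exact_mod_cast h3
      rw [Nat.descFactorial_eq_zero_iff_lt, hp, natDegree_X_sq_sub_one_pow] at this
      omega
    · exact h2 h3
  have hroot : ((derivative^[m] p).map (algebraMap ℝ ℂ)).IsRoot s := by
    rw [IsRoot, ← iterate_derivative_map, ← factorial_smul_hasseDeriv]
    have ht : taylor s (p.map (algebraMap ℝ ℂ))
        = (C (s ^ 2 - 1) + X * (C (2 * s) + X)) ^ (m + 1) := by
      rw [hp]
      simp only [Polynomial.map_pow, Polynomial.map_sub, map_X, Polynomial.map_one,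
        taylor_pow, map_sub, taylor_X, taylor_one, map_mul, map_pow, map_one]
      congr 1
      simp only [map_ofNat]
      ring
    rw [← ht, taylor_coeff] at h
    simp [h]
  obtain ⟨r, hr⟩ := (hsp.iterate_derivative_real m).mem_range_of_isRoot hne hroot
  exact ⟨r, hr⟩

/-! ### Motzkin polynomials -/

theorem succ_mul_choose_mul_catalan (m j : ℕ) :
    (m + 1) * (m.choose (2 * j) * catalan j) = (m + 1).choose (j + 1) * (m - j).choose j := by
  rcases lt_or_ge m (2 * j) with h | h
  · rw [Nat.choose_eq_zero_of_lt h]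
    rcases lt_or_ge m j with h' | h'
    · rw [Nat.choose_eq_zero_of_lt (show m + 1 < j + 1 by omega)]; simp
    · rw [Nat.choose_eq_zero_of_lt (show m - j < j by omega)]; simp
  obtain ⟨r, rfl⟩ := Nat.exists_eq_add_of_le h
  have e1 := Nat.add_choose_mul_factorial_mul_factorial (2 * j) r
  have e2 := Nat.add_choose_mul_factorial_mul_factorial (j + 1) (j + r)
  have e3 := Nat.add_choose_mul_factorial_mul_factorial j r
  rw [← Nat.choose_symm_add] at e1 e2 e3
  have e4 := Nat.add_choose_mul_factorial_mul_factorial j j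
  have e5 := succ_mul_catalan_eq_centralBinom j
  rw [Nat.centralBinom_eq_two_mul_choose, two_mul] at e5
  rw [show 2 * j + r - j = j + r by omega, show 2 * j + r + 1 = j + 1 + (j + r) by ring]
  rw [show j + 1 + (j + r) = (2 * j + r) + 1 by ring] at e2 ⊢
  rw [Nat.factorial_succ, Nat.factorial_succ] at e2
  rw [← two_mul] at e4 e5
  have hpos : 0 < j.factorial * (j + 1) * (r.factorial * j.factorial) * (j + r).factorial := by
    positivity
  apply Nat.eq_of_mul_eq_mul_right hpos
  calc _ = (2 * j + r + 1) * ((2 * j + r).choose (2 * j) *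
          (((j + 1) * catalan j) * j.factorial * j.factorial) * r.factorial)
            * (j + r).factorial := by ring
    _ = (2 * j + r + 1) * (2 * j + r).factorial * (j + r).factorial := by
        rw [e5, e4, e1]
    _ = _ := by
        rw [← e2, ← e3]; ring

section Motzkin

variable {R : Type*} [CommRing R]

/-- `motzkinPoly b c m` counts Motzkin paths of length `m` with weights `b` for level steps and
`c` for pairs of an up and a down step. -/
def motzkinPoly (b c : R) (m : ℕ) : R :=
  ∑ j ∈ Finset.range (m + 1), (m.choose (2 * j) * catalan j : ℕ) * c ^ j * b ^ (m - 2 * j)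

theorem coeff_trinomial_pow (A B : R) (m : ℕ) :
    ((C A + X * (C B + X)) ^ (m + 1) : R[X]).coeff m = (m + 1) * A * motzkinPoly B A m := by
  rw [add_pow, Finset.sum_range_succ', coeff_add, finsetSum_coeff, motzkinPoly, Finset.mul_sum]
  have hlast : (C A ^ 0 * (X * (C B + X)) ^ (m + 1 - 0) * ((m + 1).choose 0 : R[X])).coeff m
      = 0 := by
    simp [mul_pow, coeff_X_pow_mul']
  rw [hlast, add_zero]
  refine Finset.sum_congr rfl fun j hj => ?_
  have hj' : j ≤ m := Nat.lt_succ_iff.1 (Finset.mem_range.1 hj)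
  have hid : ((m : R) + 1) * ((m.choose (2 * j) * catalan j : ℕ) : R)
      = ((m + 1).choose (j + 1) : R) * ((m - j).choose j : R) := by
    exact_mod_cast congrArg (Nat.cast : ℕ → R) (succ_mul_choose_mul_catalan m j)
  have hc : ((X * (C B + X)) ^ (m - j) : R[X]).coeff m
      = B ^ (m - 2 * j) * ((m - j).choose j : R) := by
    rw [mul_pow, coeff_X_pow_mul', if_pos (Nat.sub_le _ _), add_comm (C B) X, coeff_X_add_C_pow,
      show m - (m - j) = j by omega, show m - j - j = m - 2 * j by omega]
  rw [show m + 1 - (j + 1) = m - j by omega, coeff_mul_natCast, ← C_pow, coeff_C_mul, hc]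
  linear_combination (-(A ^ (j + 1) * B ^ (m - 2 * j))) * hid

theorem coeff_X_mul_geom_pow (b : R) (m j : ℕ) :
    PowerSeries.coeff (m + 1)
        ((PowerSeries.X * PowerSeries.rescale b (PowerSeries.mk 1)) ^ (2 * j + 1))
      = (m.choose (2 * j) : R) * b ^ (m - 2 * j) := by
  rw [mul_pow, PowerSeries.coeff_X_pow_mul', ← map_pow, PowerSeries.mk_one_pow_eq_mk_choose_add]
  split_ifs with h
  · rw [PowerSeries.coeff_rescale, PowerSeries.coeff_mk,
      show 2 * j + (m + 1 - (2 * j + 1)) = m by omega,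
      show m + 1 - (2 * j + 1) = m - 2 * j by omega, mul_comm]
  · rw [Nat.choose_eq_zero_of_lt (by omega)]; simp

/-- The solution of `f = X * (1 + b * f + c * f ^ 2)` has Motzkin polynomials as coefficients. -/
theorem coeff_succ_eq_motzkinPoly [IsDomain R] {b c : R} {f : PowerSeries R}
    (hf : f = PowerSeries.X * (1 + PowerSeries.C b * f + PowerSeries.C c * f ^ 2)) (m : ℕ) :
    PowerSeries.coeff (m + 1) f = motzkinPoly b c m := by
  set E : PowerSeries R := PowerSeries.rescale b (PowerSeries.mk 1) with hE
  set Z : PowerSeries R := PowerSeries.X * E with hZ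
  set K : PowerSeries R := PowerSeries.map (Nat.castRingHom R) PowerSeries.catalanSeries with hK
  set a : PowerSeries R := PowerSeries.C c * Z ^ 2 with ha
  have hEX : E * (1 - PowerSeries.C b * PowerSeries.X) = 1 := by
    have := congrArg (PowerSeries.rescale b) (PowerSeries.mk_one_mul_one_sub_eq_one R)
    simpa [PowerSeries.rescale_X] using this
  have hKeq : K ^ 2 * PowerSeries.X + 1 = K := by
    have := congrArg (PowerSeries.map (Nat.castRingHom R))
      PowerSeries.catalanSeries_sq_mul_X_add_one
    simpa using this
  have hsub : PowerSeries.HasSubst a :=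
    PowerSeries.HasSubst.of_constantCoeff_zero' (by simp [ha, hZ])
  have hone : (1 : PowerSeries R).subst a = (1 : PowerSeries R) := by
    rw [← PowerSeries.coe_substAlgHom hsub, map_one]
  set G : PowerSeries R := K.subst a with hG
  have hGeq : G ^ 2 * a + 1 = G := by
    have := congrArg (PowerSeries.subst a) hKeq
    rwa [PowerSeries.subst_add hsub, PowerSeries.subst_mul hsub, PowerSeries.subst_pow hsub,
      PowerSeries.subst_X hsub, hone] at this
  have hZG : Z * G = PowerSeries.X * (1 + PowerSeries.C b * (Z * G)
      + PowerSeries.C c * (Z * G) ^ 2) := by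
    have h1 : Z * (1 - PowerSeries.C b * PowerSeries.X) = PowerSeries.X := by
      rw [hZ, mul_assoc, hEX, mul_one]
    have h2 : Z * G = Z + PowerSeries.C c * Z * (Z * G) ^ 2 := by
      conv_lhs => rw [← hGeq, ha]
      ring
    linear_combination (1 - PowerSeries.C b * PowerSeries.X) * h2
      + (1 + PowerSeries.C c * (Z * G) ^ 2) * h1
  have huniq : f = Z * G := by
    have h1 : (f - Z * G) * (1 - PowerSeries.X * (PowerSeries.C b
        + PowerSeries.C c * (f + Z * G))) = 0 := by
      linear_combination hf - hZG
    rcases mul_eq_zero.1 h1 with h | h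
    · exact sub_eq_zero.1 h
    · have := congrArg PowerSeries.constantCoeff h
      simp at this
  have hGtrunc : G = (∑ j ∈ Finset.range (m + 1), PowerSeries.C (catalan j : R) * a ^ j)
      + a ^ (m + 1) * (PowerSeries.mk fun i => PowerSeries.coeff (i + (m + 1)) K).subst a := by
    conv_lhs => rw [hG, PowerSeries.eq_X_pow_mul_shift_add_trunc (m + 1) K]
    rw [PowerSeries.subst_add hsub, PowerSeries.subst_mul hsub, PowerSeries.subst_pow hsub,
      PowerSeries.subst_X hsub, add_comm, PowerSeries.subst_coe hsub, aeval_eq_sum_range'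
        (n := m + 1) (PowerSeries.natDegree_trunc_lt K m)]
    congr 1
    refine Finset.sum_congr rfl fun j hj => ?_
    rw [PowerSeries.coeff_trunc, if_pos (Finset.mem_range.1 hj), PowerSeries.smul_eq_C_mul]
    simp [hK]
  rw [huniq, hGtrunc, mul_add, map_add, Finset.mul_sum, map_sum, motzkinPoly]
  have hrest : ∀ H : PowerSeries R, PowerSeries.coeff (m + 1) (Z * (a ^ (m + 1) * H)) = 0 := by
    intro H
    rw [ha, hZ,
      show PowerSeries.X * E * ((PowerSeries.C c * (PowerSeries.X * E) ^ 2) ^ (m + 1) * H)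
      = PowerSeries.X ^ (2 * m + 3) * (E * ((PowerSeries.C c * E ^ 2) ^ (m + 1) * H)) by ring,
      PowerSeries.coeff_X_pow_mul', if_neg (by omega)]
  rw [hrest, add_zero]
  refine Finset.sum_congr rfl fun j _ => ?_
  rw [ha, show Z * (PowerSeries.C (catalan j : R) * (PowerSeries.C c * Z ^ 2) ^ j)
    = PowerSeries.C ((catalan j : R) * c ^ j) * Z ^ (2 * j + 1) by
      rw [map_mul, map_pow]; ring, PowerSeries.coeff_C_mul, hZ, hE, coeff_X_mul_geom_pow]
  push_cast
  ring

end Motzkin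

/-- The Motzkin polynomial at `b = 1 + y`, `c = 2 * y` vanishes only at real `y`. -/
theorem real_of_motzkinPoly_eq_zero {m : ℕ} {y : ℂ} (h : motzkinPoly (1 + y) (2 * y) m = 0) :
    ∃ r : ℝ, (r : ℂ) = y := by
  have key : ∀ α β : ℝ, 0 ≤ β ^ 2 - α ^ 2 → α ≠ 0 → α * y ^ 2 + 2 * β * y + α = 0 →
      ∃ r : ℝ, (r : ℂ) = y := by
    intro α β hd hα hy
    have hs : ((Real.sqrt (β ^ 2 - α ^ 2) : ℝ) : ℂ) ^ 2 = (β : ℂ) ^ 2 - (α : ℂ) ^ 2 := by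
      exact_mod_cast congrArg ((↑) : ℝ → ℂ) (Real.sq_sqrt hd)
    set q := Real.sqrt (β ^ 2 - α ^ 2)
    have hα' : (α : ℂ) ≠ 0 := by exact_mod_cast hα
    have hfac : (α * y + β - q) * (α * y + β + q) = 0 := by
      linear_combination α * hy - hs
    rcases mul_eq_zero.1 hfac with h1 | h1
    · refine ⟨(q - β) / α, ?_⟩
      push_cast
      rw [div_eq_iff hα']
      linear_combination -h1
    · refine ⟨(-q - β) / α, ?_⟩
      push_cast
      rw [div_eq_iff hα']
      linear_combination -h1
  obtain ⟨w, hw⟩ := IsAlgClosed.exists_pow_nat_eq ((1 + y) ^ 2 - 8 * y) (n := 2) (by norm_num)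
  rcases eq_or_ne w 0 with rfl | hw0
  · refine key 1 (-3) (by norm_num) one_ne_zero ?_
    push_cast
    linear_combination -hw
  set s : ℂ := (1 + y) / w with hs
  have hsw : s * w = 1 + y := div_mul_cancel₀ _ hw0
  have hA : (s ^ 2 - 1) * w ^ 2 = 8 * y := by
    linear_combination (s * w + 1 + y) * hsw - hw
  have hscale : motzkinPoly (2 * s) (s ^ 2 - 1) m * w ^ m
      = 2 ^ m * motzkinPoly (1 + y) (2 * y) m := by
    rw [motzkinPoly, motzkinPoly, Finset.sum_mul, Finset.mul_sum]
    refine Finset.sum_congr rfl fun j _ => ?_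
    rcases lt_or_ge m (2 * j) with hj | hj
    · simp [Nat.choose_eq_zero_of_lt hj]
    obtain ⟨r, rfl⟩ := Nat.exists_eq_add_of_le hj
    rw [Nat.add_sub_cancel_left, ← hsw]
    calc _ = (((2 * j + r).choose (2 * j) * catalan j : ℕ) : ℂ) * ((s ^ 2 - 1) * w ^ 2) ^ j
          * (2 * (s * w)) ^ r := by
          simp only [mul_pow, pow_add, pow_mul]; ring
      _ = _ := by
          rw [hA, show (8 * y : ℂ) = 2 ^ 2 * (2 * y) by ring]
          simp only [mul_pow _ _ j, mul_pow _ _ r, pow_add, pow_mul]; ring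
  have h0 : motzkinPoly (2 * s) (s ^ 2 - 1) m = 0 := by
    rw [h, mul_zero] at hscale
    exact (mul_eq_zero.1 hscale).resolve_right (pow_ne_zero _ hw0)
  obtain ⟨r, hr⟩ := real_of_coeff_eq_zero (m := m) (s := s) (by
    rw [coeff_trinomial_pow, h0, mul_zero])
  have hquad : ((1 - r ^ 2 : ℝ) : ℂ) * y ^ 2 + 2 * ((1 + 3 * r ^ 2 : ℝ) : ℂ) * y
      + ((1 - r ^ 2 : ℝ) : ℂ) = 0 := by
    push_cast
    rw [hr]
    linear_combination (-1) * hA + (s ^ 2 - 1) * hw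
  rcases eq_or_ne (1 - r ^ 2) 0 with hr1 | hr1
  · refine ⟨0, ?_⟩
    have hs1 : s ^ 2 - 1 = 0 := by
      rw [← hr]
      exact_mod_cast (by linarith : r ^ 2 - 1 = 0)
    rw [hs1, zero_mul] at hA
    simpa [eq_comm] using hA
  · exact key _ _ (by nlinarith [sq_nonneg r, sq_nonneg (r ^ 2)]) hr1 hquad

namespace ZeroOneTree

theorem numVertices_pos (T : ZeroOneTree) : 0 < T.numVertices := by
  cases T <;> simp [numVertices]

/-- The finset of 0-1-trees on `n` vertices. -/
noncomputable def treesOn (n : ℕ) : Finset ZeroOneTree :=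
  ((finite_numVertices_le n).subset
    (fun _ hT => le_of_eq hT : {T : ZeroOneTree | T.numVertices = n} ⊆ _)).toFinset

@[simp]
theorem mem_treesOn {n : ℕ} {T : ZeroOneTree} : T ∈ treesOn n ↔ T.numVertices = n := by
  simp [treesOn]

/-- The generating polynomial of 0-1-trees on `n` vertices by the number of right edges. -/
noncomputable def rightEdgePoly (n : ℕ) : ℝ[X] :=
  ∑ T ∈ treesOn n, X ^ T.numRightEdges

theorem coeff_rightEdgePoly (n k : ℕ) :
    (rightEdgePoly n).coeff k = (boNa n (k + 1) : ℝ) := by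
  classical
  have h : boNaTrees n (k + 1) = ↑((treesOn n).filter fun T => k = T.numRightEdges) := by
    ext T
    simp [boNaTrees, eq_comm]
  rw [boNa, h, Set.ncard_coe_finset, rightEdgePoly, finsetSum_coeff]
  simp [coeff_X_pow]

theorem rightEdgePoly_zero : rightEdgePoly 0 = 0 := by
  refine Finset.sum_eq_zero fun T hT => ?_
  exact absurd (mem_treesOn.1 hT) T.numVertices_pos.ne'

theorem rightEdgePoly_succ (n : ℕ) :
    rightEdgePoly (n + 1) = (if n = 0 then 1 else 0) + (1 + X) * rightEdgePoly n
      + 2 * X * ∑ p ∈ Finset.HasAntidiagonal.antidiagonal n, rightEdgePoly p.1 * rightEdgePoly p.2 := by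
  classical
  have hdecomp : treesOn (n + 1) = (if n = 0 then {leaf} else ∅) ∪
      ((treesOn n).image left ∪ ((treesOn n).image right ∪
        (Finset.HasAntidiagonal.antidiagonal n).biUnion fun p =>
          (Finset.univ ×ˢ (treesOn p.1 ×ˢ treesOn p.2)).image fun q => both q.1 q.2.1 q.2.2)) := by
    ext T
    cases T with
    | leaf => by_cases h : n = 0 <;> simp [numVertices, h, eq_comm]
    | left l => by_cases h : n = 0 <;> simp [numVertices, h]
    | right r => by_cases h : n = 0 <;> simp [numVertices, h]
    | both b l r => by_cases h : n = 0 <;> simp [numVertices, h]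
  have hdisj : Set.PairwiseDisjoint (↑(Finset.HasAntidiagonal.antidiagonal n)) fun p : ℕ × ℕ =>
      (Finset.univ ×ˢ (treesOn p.1 ×ˢ treesOn p.2)).image
        fun q : Fin 2 × ZeroOneTree × ZeroOneTree => both q.1 q.2.1 q.2.2 := by
    intro p _ p' _ hne
    refine Finset.disjoint_left.2 fun T hT hT' => hne ?_
    simp only [Finset.mem_image, Finset.mem_product, mem_treesOn, Prod.exists] at hT hT'
    obtain ⟨b, l, r, ⟨-, h1, h2⟩, rfl⟩ := hT
    obtain ⟨b', l', r', ⟨-, h1', h2'⟩, he⟩ := hT'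
    injection he with _ e1 e2
    subst e1 e2
    exact Prod.ext (h1.symm.trans h1') (h2.symm.trans h2')
  rw [rightEdgePoly, hdecomp, Finset.sum_union, Finset.sum_union, Finset.sum_union,
    Finset.sum_biUnion hdisj, Finset.sum_image, Finset.sum_image]
  · have hboth : ∀ p ∈ Finset.HasAntidiagonal.antidiagonal n,
        ∑ T ∈ (Finset.univ ×ˢ (treesOn p.1 ×ˢ treesOn p.2)).image
          (fun q : Fin 2 × ZeroOneTree × ZeroOneTree => both q.1 q.2.1 q.2.2),
            (X : ℝ[X]) ^ T.numRightEdges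
          = 2 * X * (rightEdgePoly p.1 * rightEdgePoly p.2) := by
      intro p _
      rw [Finset.sum_image, Finset.sum_product, Fin.sum_univ_two, Finset.sum_product,
        Finset.sum_product, rightEdgePoly, rightEdgePoly, Finset.sum_mul_sum]
      · simp only [numRightEdges, Finset.mul_sum, pow_add, pow_one, ← Finset.sum_add_distrib]
        refine Finset.sum_congr rfl fun _ _ => Finset.sum_congr rfl fun _ _ => by ring
      · rintro ⟨b, l, r⟩ _ ⟨b', l', r'⟩ _ h
        simpa using h
    rw [Finset.sum_congr rfl hboth, ← Finset.mul_sum]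
    have hleaf : ∑ T ∈ (if n = 0 then {leaf} else ∅ : Finset ZeroOneTree),
        (X : ℝ[X]) ^ T.numRightEdges = if n = 0 then 1 else 0 := by
      split_ifs <;> simp [numRightEdges]
    rw [hleaf, rightEdgePoly]
    simp only [numRightEdges, pow_succ, ← Finset.sum_mul]
    ring
  · intro _ _ _ _ h; simpa using h
  · intro _ _ _ _ h; simpa using h
  · refine Finset.disjoint_left.2 fun T h h' => ?_
    cases T <;> simp at h h'
  · refine Finset.disjoint_left.2 fun T h h' => ?_
    cases T <;> simp at h h'
  · refine Finset.disjoint_left.2 fun T h h' => ?_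
    by_cases hn : n = 0 <;> cases T <;> simp [hn] at h h'

theorem aeval_rightEdgePoly_succ (y : ℂ) (m : ℕ) :
    aeval y (rightEdgePoly (m + 1)) = motzkinPoly (1 + y) (2 * y) m := by
  have h := coeff_succ_eq_motzkinPoly (b := 1 + y) (c := 2 * y)
    (f := PowerSeries.mk fun n => aeval y (rightEdgePoly n)) ?_ m
  · rwa [PowerSeries.coeff_mk] at h
  ext n
  cases n with
  | zero => simp [rightEdgePoly_zero]
  | succ n =>
    rw [PowerSeries.coeff_succ_X_mul, PowerSeries.coeff_mk, rightEdgePoly_succ, map_add, map_add,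
      map_add, map_add, PowerSeries.coeff_C_mul, PowerSeries.coeff_C_mul, sq, PowerSeries.coeff_mul,
      PowerSeries.coeff_one]
    split_ifs <;> simp [show aeval y (2 : ℝ[X]) = 2 from map_ofNat _ 2]

theorem splits_rightEdgePoly (n : ℕ) : (rightEdgePoly n).Splits := by
  cases n with
  | zero => rw [rightEdgePoly_zero]; exact Splits.zero
  | succ m =>
    refine Splits.of_splits_map (algebraMap ℝ ℂ) (IsAlgClosed.splits _) fun y hy => ?_
    have hy' := (mem_roots'.1 hy).2
    rw [IsRoot, eval_map_algebraMap, aeval_rightEdgePoly_succ] at hy'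
    exact real_of_motzkinPoly_eq_zero hy'

end ZeroOneTree

theorem mainTheorem4 (n : ℕ) :
    IsLogConcaveUpTo n (fun k => (boNa n k : ℝ)) := by
  refine ⟨fun i _ _ => Nat.cast_nonneg _, fun i hi _ => ?_⟩
  obtain ⟨k, rfl⟩ : ∃ k, i = k + 2 := ⟨i - 2, by omega⟩
  have h := (stronglyLogConcave_of_splits (ZeroOneTree.splits_rightEdgePoly n) fun i => by
    rw [ZeroOneTree.coeff_rightEdgePoly]; exact Nat.cast_nonneg _).2 k (k + 1) k.le_succ
  simp only [ZeroOneTree.coeff_rightEdgePoly] at h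
  rw [sq]
  exact h
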